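/- Let $\mathcal M\subseteq\mathbb R^N$ be a compact $m$-dimensional Riemannian submanifold (a smooth embedded submanifold without boundary, with the induced metric). The medial axis of $\mathcal M$ is the closure of the set of points of $\mathbb R^N$ that have more than one nearest neighbour on $\mathcal M$, and for $x\in\mathcal M$ the local feature size $\mathrm{lfs}(x)$ is the distance of $x$ to the medial axis (if the medial axis is empty, which happens for nonempty $\mathcal M$ only when $\mathcal M$ is a single point, put $\mathrm{lfs}=0$). Let $p\in\mathcal M$, let $T_p\mathcal M$ be the tangent space of $\mathcal M$ at $p$, regarded as an affine subspace of $\mathbb R^N$ through $p$, let $\pi_p:\mathcal M\to T_p\mathcal M$ be the orthogonal projection, and put $r=\mathrm{lfs}(p)/10$, $r'=19\,\mathrm{lfs}(p)/200$, $\overline B_{|\mathcal M}(p,r)=\{y\in\mathcal M:\|p-y\|\le r\}$, $\overline B_{|T_p\mathcal M}(p,r')=\{x\in T_p\mathcal M:\|p-x\|\le r'\}$. Then: (i) $\pi_p$ restricted to $\overline B_{|\mathcal M}(p,r)$ is an embedding, that is, it is a homeomorphism onto its image, and the differential of $\pi_p$ is injective at every point of $\overline B_{|\mathcal M}(p,r)$.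 (ii) $\overline B_{|T_p\mathcal M}(p,r')\subseteq\pi_p\bigl(\overline B_{|\mathcal M}(p,r)\bigr)$. (iii) Let $x\in T_p\mathcal M$ with $\|p-x\|=t\,\mathrm{lfs}(p)$ and $t\le\frac{19}{200}$. Then there is exactly one point of $\overline B_{|\mathcal M}(p,r)$, denoted $\pi_p^{-1}(x)$, that $\pi_p$ maps to $x$, and $$\|x-\pi_p^{-1}(x)\|\le\frac{t^2\,\mathrm{lfs}(p)}{1+\sqrt{1-t^2}} .$$ Consequently, with $\operatorname{dist}(x,\mathcal M)=\inf_{y\in\mathcal M}\|x-y\|$, $$\operatorname{dist}(x,\mathcal M)\le\bigl(1-\sqrt{1-t^2}\bigr)\mathrm{lfs}(p)=\frac{t^2\,\mathrm{lfs}(p)}{1+\sqrt{1-t^2}} .$$ (When $\mathrm{lfs}(p)=0$, the square root of a negative number is read as $0$.) -/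

import Mathlib

open scoped Manifold ContDiff Topology

noncomputable section

/-- The Euclidean space `ℝᴺ`. -/
abbrev Euc (N : ℕ) : Type := EuclideanSpace ℝ (Fin N)

/-- The medial axis of `S`: the closure of the set of points that have more than one nearest
neighbour on `S`. -/
def medialAxis {N : ℕ} (S : Set (Euc N)) : Set (Euc N) :=
  closure {x | ∃ y ∈ S, ∃ z ∈ S, y ≠ z ∧
    dist x y = Metric.infDist x S ∧ dist x z = Metric.infDist x S}

/-- The local feature size: the distance to the medial axis. (If the medial axis is empty this
is `0` by convention; for a nonempty compact submanifold without boundary that happens only for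
a one-point space.) -/
def lfs {N : ℕ} (S : Set (Euc N)) (x : Euc N) : ℝ :=
  Metric.infDist x (medialAxis S)

/-- `M ⊆ ℝᴺ`, with the given smooth structure modelled on `ℝᵐ`, is a compact `m`-dimensional
smooth embedded submanifold without boundary of `ℝᴺ`. (The Riemannian metric is the induced one
and carries no additional data.) -/
structure IsCompactSubmanifold {N : ℕ} (m : ℕ) (M : Set (Euc N)) [ChartedSpace (Euc m) M] :
    Prop where
  isManifold : IsManifold (𝓡 m) ∞ M
  isCompact : IsCompact M
  isSmoothEmbedding : Manifold.IsSmoothEmbedding (𝓡 m) 𝓘(ℝ, Euc N) ∞ (Subtype.val : M → Euc N)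

/-- The linear tangent space of `M` at `p`, as a subspace of `ℝᴺ`: the range of the differential
at `p` of the inclusion `M → ℝᴺ`. -/
def tangentDir {N : ℕ} (m : ℕ) (M : Set (Euc N)) [ChartedSpace (Euc m) M] (p : M) :
    Submodule ℝ (Euc N) :=
  LinearMap.range (M := TangentSpace (𝓡 m) p) (M₂ := Euc N)
    (mfderiv (𝓡 m) 𝓘(ℝ, Euc N) (Subtype.val : M → Euc N) p).toLinearMap

/-- The tangent space `T_p M` as an affine subspace of `ℝᴺ` through `p`. -/
abbrev tangentPlane {N : ℕ} (m : ℕ) (M : Set (Euc N)) [ChartedSpace (Euc m) M] (p : M) :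
    AffineSubspace ℝ (Euc N) :=
  AffineSubspace.mk' (p : Euc N) (tangentDir m M p)

/-- The orthogonal projection `π_p : M → T_p M`. -/
def tangentProj {N : ℕ} (m : ℕ) (M : Set (Euc N)) [ChartedSpace (Euc m) M] (p : M) (y : M) :
    tangentPlane m M p :=
  EuclideanGeometry.orthogonalProjection (tangentPlane m M p) (y : Euc N)

end

/-! Everything rests on Federer's estimate `IsCompactSubmanifold.two_mul_lfs_mul_norm_le`: a point
`z` of `M` deviates from the tangent plane at `y` by at most `‖z - y‖² / (2 lfs y)` when `lfs y >
0`. Equivalently, open balls of radius `lfs y` tangent to `M` at `y` miss `M`. Small tangent balls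
miss `M` by second-order contact, and they can be enlarged up to radius `lfs y` because off the
medial axis the distance to `M` grows at unit speed away from the nearest point.

Call `y` good if its tangent space meets the normal space at `p` only in `0`. Where all points are
good, minimising the distance to a target in `T_p M` shows that the projection covers a large ball
(`exists_starProjection_eq`). The points so obtained span the directions of `T_p M`, and Federer's
estimate at `p` and at `y` then bounds the tilt between the tangent spaces
(`norm_sub_starProjection_le_of_good`). A bad point closest to `p` would satisfy this bound and
hence be good, so there is none. Injectivity comes from the tilt bound, the height bound from
Federer's estimate at `p` and Pythagoras. -/

/-! ### Growth of the distance function off the medial axis. -/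

theorem exists_pos_forall_nearest_dist_lt {N : ℕ} {S : Set (Euc N)} (hS : IsCompact S)
    {x q : Euc N} (hx : x ∉ medialAxis S) (hq : q ∈ S) (hxq : dist x q = Metric.infDist x S)
    {η : ℝ} (hη : 0 < η) :
    ∃ δ > 0, ∀ x' q', dist x' x < δ → q' ∈ S → dist x' q' = Metric.infDist x' S →
      dist q' q < η := by
  have hK : IsCompact (S \ Metric.ball q η) := hS.diff Metric.isOpen_ball
  rcases (S \ Metric.ball q η).eq_empty_or_nonempty with h0 | hne
  · refine ⟨1, one_pos, fun x' q' _ hq' _ => ?_⟩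
    by_contra hc
    have : q' ∈ S \ Metric.ball q η := ⟨hq', by simpa using hc⟩
    simp [h0] at this
  · obtain ⟨z, hz, hzd⟩ := hK.exists_infDist_eq_dist hne x
    -- Equality would give `x` the two nearest points `q` and `z`. The gap here is what determines
    -- `δ`.
    have hlt : Metric.infDist x S < dist x z := by
      refine lt_of_le_of_ne (Metric.infDist_le_dist_of_mem hz.1) fun he => hx ?_
      refine subset_closure ⟨q, hq, z, hz.1, ?_, hxq, he.symm⟩
      rintro rfl
      exact hz.2 (Metric.mem_ball_self hη)
    refine ⟨(dist x z - Metric.infDist x S) / 2, by linarith, fun x' q' hx' hq' hd => ?_⟩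
    by_contra hc
    have hmem : q' ∈ S \ Metric.ball q η := ⟨hq', by simpa using hc⟩
    have h1 : dist x z ≤ dist x q' := hzd ▸ Metric.infDist_le_dist_of_mem hmem
    have h2 : Metric.infDist x' S ≤ Metric.infDist x S + dist x' x :=
      Metric.infDist_le_infDist_add_dist
    have h3 := dist_triangle_left x q' x'
    linarith

/-- Nearest points of `x + h v` stay close to `q`, so expanding the squared distance to them gives
one-sided slope almost 1 in the direction `v` away from `q`. -/
theorem eventually_infDist_add_smul_gt {N : ℕ} {S : Set (Euc N)} (hS : IsCompact S)
    {x q : Euc N} (hx : x ∉ medialAxis S) (hq : q ∈ S) (hxq : dist x q = Metric.infDist x S)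
    (hd : 0 < dist x q) {ε : ℝ} (hε : 0 < ε) (hε1 : ε < 1) :
    ∀ᶠ h in 𝓝[>] (0 : ℝ),
      dist x q + (1 - ε) * h < Metric.infDist (x + h • ((dist x q)⁻¹ • (x - q))) S := by
  obtain ⟨δ, hδ, H⟩ := exists_pos_forall_nearest_dist_lt hS hx hq hxq (mul_pos hd hε)
  filter_upwards [Ioo_mem_nhdsGT hδ] with h hh
  set d := dist x q with hd_def
  set v := d⁻¹ • (x - q) with hv_def
  have hdv : x - q = d • v := by rw [hv_def, smul_smul, mul_inv_cancel₀ hd.ne', one_smul]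
  have hv : ‖v‖ = 1 := by
    rw [hv_def, norm_smul, ← dist_eq_norm, ← hd_def, norm_inv, Real.norm_of_nonneg hd.le,
      inv_mul_cancel₀ hd.ne']
  obtain ⟨q', hq', hd'⟩ := hS.exists_infDist_eq_dist ⟨q, hq⟩ (x + h • v)
  have hqq : dist q' q < d * ε := by
    refine H (x + h • v) q' ?_ hq' hd'.symm
    rw [dist_eq_norm, add_sub_cancel_left, norm_smul, hv, mul_one, Real.norm_of_nonneg hh.1.le]
    exact hh.2
  rw [hd']
  have h1 : d ≤ dist x q' := by rw [hxq]; exact Metric.infDist_le_dist_of_mem hq'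
  have h2 : inner ℝ (q' - q) v ≤ d * ε := by
    refine (real_inner_le_norm _ _).trans ?_
    rw [hv, mul_one, ← dist_eq_norm]; exact hqq.le
  have h3 : dist (x + h • v) q' ^ 2 = dist x q' ^ 2 + 2 * h * (d - inner ℝ (q' - q) v) + h ^ 2 := by
    have e : x + h • v - q' = (x - q') + h • v := by abel
    have e2 : x - q' = d • v - (q' - q) := by rw [← hdv]; abel
    have e3 : inner ℝ (x - q') v = d - inner ℝ (q' - q) v := by
      rw [e2, inner_sub_left, real_inner_smul_left, real_inner_self_eq_norm_sq, hv]; ring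
    rw [dist_eq_norm, dist_eq_norm, e, norm_add_sq_real, real_inner_smul_right, e3, norm_smul,
      hv, Real.norm_of_nonneg hh.1.le]
    ring
  have hpos := hh.1
  refine lt_of_pow_lt_pow_left₀ 2 dist_nonneg ?_
  rw [h3]
  have h4 : d ^ 2 ≤ dist x q' ^ 2 := by gcongr
  have h5 : (1 - ε) ^ 2 * h ^ 2 < h ^ 2 := by
    have : (1 - ε) ^ 2 < 1 := by nlinarith
    have := mul_lt_mul_of_pos_right this (pow_pos hpos 2)
    linarith
  have h6 : 0 ≤ h * (d * ε - inner ℝ (q' - q) v) := mul_nonneg hpos.le (by linarith)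
  nlinarith

/-- A variational substitute for following the gradient flow for time `T`: a maximiser of the
distance to `S` penalised by `(1 - ε) * dist w x` must lie on the boundary sphere, since at an
interior point one could still move away from `S` at a speed above `1 - ε`. -/
theorem exists_infDist_eq_add {N : ℕ} {S : Set (Euc N)} (hS : IsCompact S) (hne : S.Nonempty)
    {x : Euc N} {T : ℝ} (hT : 0 < T) (hm : ∀ z ∈ Metric.closedBall x T, z ∉ medialAxis S)
    (hd : ∀ z ∈ Metric.closedBall x T, 0 < Metric.infDist z S) :
    ∃ z ∈ Metric.closedBall x T, Metric.infDist x S + T ≤ Metric.infDist z S := by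
  have hcB : IsCompact (Metric.closedBall x T) := isCompact_closedBall x T
  have hneB : (Metric.closedBall x T).Nonempty := ⟨x, Metric.mem_closedBall_self hT.le⟩
  -- This point is fixed before `ε`, so no limit of the `ε`-dependent maximisers is needed.
  obtain ⟨z, hz, hmax⟩ := hcB.exists_isMaxOn hneB (Metric.continuous_infDist_pt S).continuousOn
  refine ⟨z, hz, ?_⟩
  refine le_of_forall_pos_lt_add fun e he => ?_
  obtain ⟨ε, hε, hε1, hεe⟩ : ∃ ε : ℝ, 0 < ε ∧ ε < 1 ∧ ε * T < e := by
    refine ⟨min (1 / 2) (e / (2 * T)), by positivity, by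
      exact (min_le_left _ _).trans_lt (by norm_num), ?_⟩
    calc min (1 / 2) (e / (2 * T)) * T ≤ e / (2 * T) * T := by gcongr; exact min_le_right _ _
      _ = e / 2 := by field_simp
      _ < e := by linarith
  let f : Euc N → ℝ := fun w => Metric.infDist w S - (1 - ε) * dist w x
  have hf : Continuous f := by
    have := Metric.continuous_infDist_pt S
    fun_prop
  obtain ⟨w, hw, hwmax⟩ := hcB.exists_isMaxOn hneB hf.continuousOn
  have hwT : dist w x = T := by
    by_contra hc
    have hlt : dist w x < T := lt_of_le_of_ne hw hc
    obtain ⟨q, hq, hwq⟩ := hS.exists_infDist_eq_dist hne w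
    have hpos : 0 < dist w q := hwq ▸ hd w hw
    have h1 := eventually_infDist_add_smul_gt hS (hm w hw) hq hwq.symm hpos hε hε1
    have h0 : ∀ᶠ h in 𝓝[>] (0 : ℝ), h ∈ Set.Ioo 0 (T - dist w x) :=
      Ioo_mem_nhdsGT (sub_pos.2 hlt)
    obtain ⟨h, hh, hgt⟩ := (h0.and h1).exists
    set w' := w + h • ((dist w q)⁻¹ • (w - q))
    have hww : dist w' w = h := by
      rw [dist_eq_norm, add_sub_cancel_left, norm_smul, norm_smul, ← dist_eq_norm, norm_inv,
        Real.norm_of_nonneg hpos.le, inv_mul_cancel₀ hpos.ne', Real.norm_of_nonneg hh.1.le, mul_one]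
    have htri := dist_triangle w' w x
    have hw' : w' ∈ Metric.closedBall x T := by
      rw [Metric.mem_closedBall]; linarith [hh.2]
    have := hwmax hw'
    simp only [f, Set.mem_ofPred_eq] at this
    rw [hwq] at this
    nlinarith
  have hx := hwmax (Metric.mem_closedBall_self (x := x) hT.le)
  have hzw := hmax hw
  simp only [f, Set.mem_ofPred_eq, hwT, dist_self] at hx hzw
  linarith

/-! ### Empty tangent balls. -/

/-- For `s > 0`, the inequality with coefficient `2 * s` says that the open ball of radius `s`
centred at `y + s • n` misses `S`. The largest such `s ≤ lfs S y` cannot be smaller than `lfs S y`,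
as the ball could then be enlarged. -/
theorem two_mul_lfs_mul_inner_le {N : ℕ} {S : Set (Euc N)} (hS : IsCompact S)
    {y n : Euc N} (hy : y ∈ S) (hn : ‖n‖ = 1) {s₀ : ℝ} (hs₀ : 0 < s₀)
    (h : ∀ z ∈ S, 2 * s₀ * inner ℝ (z - y) n ≤ ‖z - y‖ ^ 2) :
    ∀ z ∈ S, 2 * lfs S y * inner ℝ (z - y) n ≤ ‖z - y‖ ^ 2 := by
  set l := lfs S y with hl
  have hdist : ∀ (s : ℝ) (z : Euc N),
      dist (y + s • n) z ^ 2 = s ^ 2 + (‖z - y‖ ^ 2 - 2 * s * inner ℝ (z - y) n) := by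
    intro s z
    have e : y + s • n - z = s • n - (z - y) := by abel
    rw [dist_eq_norm, e, norm_sub_sq_real, real_inner_smul_left, norm_smul, hn,
      real_inner_comm, mul_one, Real.norm_eq_abs, sq_abs]
    ring
  rcases le_or_gt l s₀ with hls | hls
  · intro z hz
    rcases le_or_gt 0 (inner ℝ (z - y) n) with h0 | h0
    · exact le_trans (by gcongr) (h z hz)
    · have : 0 ≤ l := Metric.infDist_nonneg
      nlinarith [sq_nonneg ‖z - y‖]
  let A : Set ℝ := {s | s ∈ Set.Icc s₀ l ∧ ∀ z ∈ S, 2 * s * inner ℝ (z - y) n ≤ ‖z - y‖ ^ 2}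
  have hA : IsCompact A := by
    refine isCompact_Icc.inter_right (s := Set.Icc s₀ l)
      (t := {s | ∀ z ∈ S, 2 * s * inner ℝ (z - y) n ≤ ‖z - y‖ ^ 2}) ?_
    simp only [Set.ofPred_forall]
    exact isClosed_biInter fun z _ => isClosed_le (by fun_prop) (by fun_prop)
  obtain ⟨s, hsA, hsmax⟩ := hA.exists_isGreatest ⟨s₀, ⟨le_rfl, hls.le⟩, h⟩
  obtain ⟨⟨hs0, hsl⟩, hs⟩ := hsA
  rcases hsl.eq_or_lt with rfl | hlt
  · exact hs
  exfalso
  have hspos : 0 < s := hs₀.trans_le hs0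
  have hinf : s ≤ Metric.infDist (y + s • n) S := by
    refine (Metric.le_infDist ⟨y, hy⟩).2 fun {z} hz => ?_
    refine le_of_sq_le_sq ?_ dist_nonneg
    rw [hdist]; linarith [hs z hz]
  -- The first bound keeps the ball about `y + s • n` off the medial axis, the second keeps it off
  -- `S`.
  set T := min ((l - s) / 2) (s / 2) with hT
  have hTpos : 0 < T := lt_min (by linarith) (by linarith)
  have hT1 : T ≤ (l - s) / 2 := min_le_left _ _
  have hT2 : T ≤ s / 2 := min_le_right _ _
  have hxy : dist (y + s • n) y = s := by
    rw [dist_eq_norm, add_sub_cancel_left, norm_smul, hn, Real.norm_of_nonneg hspos.le, mul_one]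
  obtain ⟨x, hx, hxT⟩ := exists_infDist_eq_add hS ⟨y, hy⟩ (x := y + s • n) hTpos
    (fun z hz hzm => by
      have h1 : l ≤ dist y z := Metric.infDist_le_dist_of_mem hzm
      have h2 := dist_triangle_right y z (y + s • n)
      rw [Metric.mem_closedBall] at hz
      rw [dist_comm y (y + s • n), hxy] at h2
      linarith)
    (fun z hz => by
      have h2 : Metric.infDist (y + s • n) S ≤ Metric.infDist z S + dist (y + s • n) z :=
        Metric.infDist_le_infDist_add_dist
      rw [Metric.mem_closedBall, dist_comm] at hz
      linarith)
  have hxS : ∀ z ∈ S, s + T ≤ dist x z := fun z hz =>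
    (by linarith : s + T ≤ Metric.infDist x S).trans (Metric.infDist_le_dist_of_mem hz)
  have hx' : ‖x - y - s • n‖ ≤ T := by
    rw [Metric.mem_closedBall, dist_eq_norm] at hx
    rwa [sub_sub]
  have hxy2 : ‖x - y‖ ≤ s + T := by
    rw [← dist_eq_norm]
    have := dist_triangle x (y + s • n) y
    rw [Metric.mem_closedBall] at hx
    linarith
  have hxy1 : s + T ≤ ‖x - y‖ := by rw [← dist_eq_norm]; exact hxS y hy
  have hxe : ‖x - y‖ = s + T := le_antisymm hxy2 hxy1
  -- Equality holds in the triangle inequality through `y + s • n`, so `x` is forced onto the normal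
  -- ray.
  have hin : s + T ≤ inner ℝ (x - y) n := by
    have h1 : ‖x - y - s • n‖ ^ 2 ≤ T ^ 2 := by gcongr
    rw [norm_sub_sq_real, real_inner_smul_right, norm_smul, hn, hxe, mul_one, Real.norm_eq_abs,
      sq_abs] at h1
    have : s * (s + T) ≤ s * inner ℝ (x - y) n := by nlinarith
    exact le_of_mul_le_mul_left this hspos
  have hz0 : ‖x - y - (s + T) • n‖ ^ 2 ≤ 0 := by
    rw [norm_sub_sq_real, real_inner_smul_right, norm_smul, hn, hxe, mul_one, Real.norm_eq_abs,
      sq_abs]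
    nlinarith
  have hxeq : x = y + (s + T) • n := by
    have : ‖x - y - (s + T) • n‖ = 0 := by nlinarith [norm_nonneg (x - y - (s + T) • n)]
    rw [norm_eq_zero, sub_eq_zero] at this
    rw [← this]; abel
  have hmem : s + T ∈ A := by
    refine ⟨⟨by linarith, by linarith⟩, fun z hz => ?_⟩
    have h1 : (s + T) ^ 2 ≤ dist x z ^ 2 := by
      have := hxS z hz
      gcongr
    rw [hxeq, hdist] at h1
    linarith
  linarith [hsmax hmem]

/-! ### Local parametrizations and tangent spaces. -/

theorem mem_tangentDir_iff {N m : ℕ} {M : Set (Euc N)} [ChartedSpace (Euc m) M] {p : M}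
    {w : Euc N} : w ∈ tangentDir m M p ↔
      ∃ v : Euc m, (mfderiv (𝓡 m) 𝓘(ℝ, Euc N) (Subtype.val : M → Euc N) p : Euc m →L[ℝ] Euc N) v
        = w := Iff.rfl

/-- In immersion charts the inclusion reads `u ↦ (u, 0)`; `L` is the first component of the ambient
chart. -/
theorem IsCompactSubmanifold.exists_chart {N m : ℕ} {M : Set (Euc N)} [ChartedSpace (Euc m) M]
    (hM : IsCompactSubmanifold m M) (y : M) :
    ∃ (e : OpenPartialHomeomorph M (Euc m)) (L : Euc N → Euc m), y ∈ e.source ∧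
      ContDiffOn ℝ ∞ (fun u => (e.symm u : Euc N)) e.target ∧
      (∀ z ∈ e.source, L z = e z ∧ DifferentiableAt ℝ L z) ∧
      (∀ u ∈ e.target, MDifferentiableAt (𝓡 m) (𝓡 m) e.symm u) := by
  have hi := hM.isSmoothEmbedding.isImmersion.isImmersionAt y
  have he := hi.domChart_mem_maximalAtlas
  have hc := hi.codChart_mem_maximalAtlas
  have hs : ContMDiffOn (𝓡 m) (𝓡 m) ∞ hi.domChart.symm hi.domChart.target :=
    contMDiffOn_symm_of_mem_maximalAtlas he
  have hv := hM.isSmoothEmbedding.contMDiff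
  refine ⟨hi.domChart, fun z => (hi.equiv.symm (hi.codChart z)).1, hi.mem_domChart_source,
    ?_, fun z hz => ⟨?_, ?_⟩, fun u hu => ?_⟩
  · exact contMDiffOn_iff_contDiffOn.1 (hv.comp_contMDiffOn hs)
  · have h := hi.writtenInCharts (show hi.domChart z ∈ (hi.domChart.extend (𝓡 m)).target by
      rw [OpenPartialHomeomorph.extend_target]
      simpa using hi.domChart.map_source hz)
    have h' : hi.codChart (z : Euc N) = hi.equiv (hi.domChart z, 0) := by
      simpa [hi.domChart.left_inv hz] using h
    simp [h']
  · have h1 : DifferentiableAt ℝ hi.codChart (z : Euc N) := by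
      refine mdifferentiableAt_iff_differentiableAt.1
        ((contMDiffAt_of_mem_maximalAtlas hc ?_).mdifferentiableAt (by simp))
      exact hi.source_subset_preimage_source hz
    have h2 : DifferentiableAt ℝ (fun z => hi.equiv.symm (hi.codChart z)) (z : Euc N) :=
      hi.equiv.symm.differentiableAt.comp _ h1
    exact h2.fst
  · exact (hs.contMDiffAt (hi.domChart.open_target.mem_nhds hu)).mdifferentiableAt (by simp)

/-- A local parametrization `e.symm` of `M` around `y`, with a differentiable left inverse `L`. -/
theorem IsCompactSubmanifold.exists_parametrization {N m : ℕ} {M : Set (Euc N)}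
    [ChartedSpace (Euc m) M] (hM : IsCompactSubmanifold m M) (y : M) :
    ∃ (e : OpenPartialHomeomorph M (Euc m)) (L : Euc N → Euc m), y ∈ e.source ∧
      ContDiffOn ℝ ∞ (fun u => (e.symm u : Euc N)) e.target ∧
      (∀ z ∈ e.source, L z = e z ∧ DifferentiableAt ℝ L z) ∧
      ∀ u ∈ e.target,
        Function.Injective (fderiv ℝ (fun u => (e.symm u : Euc N)) u) ∧
        Function.Injective (mfderiv (𝓡 m) 𝓘(ℝ, Euc N) (Subtype.val : M → Euc N) (e.symm u)) ∧
        (fderiv ℝ (fun u => (e.symm u : Euc N)) u).range = tangentDir m M (e.symm u) := by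
  obtain ⟨e, L, hy, hsm, hL, hmd⟩ := hM.exists_chart y
  refine ⟨e, L, hy, hsm, hL, fun u hu => ?_⟩
  set φ : Euc m → Euc N := fun u => (e.symm u : Euc N) with hφ
  have hφd : DifferentiableAt ℝ φ u :=
    (hsm.differentiableOn (by simp)).differentiableAt (e.open_target.mem_nhds hu)
  have hinj : Function.Injective (fderiv ℝ φ u) := by
    have hLd : DifferentiableAt ℝ L (φ u) := (hL _ (e.map_target hu)).2
    have hcomp : HasFDerivAt (L ∘ φ) ((fderiv ℝ L (φ u)).comp (fderiv ℝ φ u)) u :=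
      hLd.hasFDerivAt.comp u hφd.hasFDerivAt
    have hid : HasFDerivAt (L ∘ φ) (ContinuousLinearMap.id ℝ (Euc m)) u := by
      refine (hasFDerivAt_id u).congr_of_eventuallyEq ?_
      filter_upwards [e.open_target.mem_nhds hu] with x hx
      simp only [Function.comp, hφ, id]
      rw [(hL _ (e.map_target hx)).1, e.right_inv hx]
    have heq := hcomp.unique hid
    intro a b hab
    have := congrArg (fderiv ℝ L (φ u)) hab
    have h1 : ∀ c, fderiv ℝ L (φ u) (fderiv ℝ φ u c) = c := fun c =>
      DFunLike.congr_fun heq c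
    rwa [h1, h1] at this
  let A : Euc m →L[ℝ] Euc N := mfderiv (𝓡 m) 𝓘(ℝ, Euc N) (Subtype.val : M → Euc N) (e.symm u)
  let B : Euc m →L[ℝ] Euc m := mfderiv (𝓡 m) (𝓡 m) e.symm u
  have hAB : fderiv ℝ φ u = A.comp B := by
    rw [← mfderiv_eq_fderiv]
    exact mfderiv_comp u ((hM.isSmoothEmbedding.contMDiff.mdifferentiable (by simp)) _) (hmd u hu)
  have hBinj : Function.Injective B := by
    intro a b hab
    refine hinj ?_
    rw [hAB, ContinuousLinearMap.comp_apply, ContinuousLinearMap.comp_apply, hab]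
  -- Source and target have the same dimension `m`, so `A` inherits both injectivity and range from
  -- `fderiv ℝ φ u`.
  have hBsurj : Function.Surjective B :=
    (LinearMap.injective_iff_surjective (f := (B : Euc m →ₗ[ℝ] Euc m))).1 hBinj
  refine ⟨hinj, ?_, ?_⟩
  · change Function.Injective A
    intro a b hab
    obtain ⟨a, rfl⟩ := hBsurj a
    obtain ⟨b, rfl⟩ := hBsurj b
    have : fderiv ℝ φ u a = fderiv ℝ φ u b := by
      rw [hAB]; exact hab
    rw [hinj this]
  · ext w
    rw [mem_tangentDir_iff]
    constructor
    · rintro ⟨v, rfl⟩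
      exact ⟨B v, by change A (B v) = fderiv ℝ φ u v; rw [hAB]; rfl⟩
    · rintro ⟨v, rfl⟩
      obtain ⟨v, rfl⟩ := hBsurj v
      exact ⟨v, by change fderiv ℝ φ u v = A (B v); rw [hAB]; rfl⟩

theorem IsCompactSubmanifold.injective_mfderiv_val {N m : ℕ} {M : Set (Euc N)}
    [ChartedSpace (Euc m) M] (hM : IsCompactSubmanifold m M) (y : M) :
    Function.Injective (mfderiv (𝓡 m) 𝓘(ℝ, Euc N) (Subtype.val : M → Euc N) y) := by
  obtain ⟨e, L, hy, -, -, h⟩ := hM.exists_parametrization y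
  have := (h _ (e.map_source hy)).2.1
  rwa [e.left_inv hy] at this

theorem IsCompactSubmanifold.finrank_tangentDir {N m : ℕ} {M : Set (Euc N)}
    [ChartedSpace (Euc m) M] (hM : IsCompactSubmanifold m M) (y : M) :
    Module.finrank ℝ (tangentDir m M y) = m := by
  let A : Euc m →L[ℝ] Euc N := mfderiv (𝓡 m) 𝓘(ℝ, Euc N) (Subtype.val : M → Euc N) y
  have hA : Function.Injective A := hM.injective_mfderiv_val y
  have : Module.finrank ℝ (LinearMap.range (A : Euc m →ₗ[ℝ] Euc N)) = m := by
    rw [LinearMap.finrank_range_of_inj hA, finrank_euclideanSpace_fin]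
  exact this

/-! ### Second-order contact with the tangent space. -/

theorem isBigO_sub_sq_of_fderiv_eq_zero {E : Type*} [NormedAddCommGroup E] [NormedSpace ℝ E]
    {g : E → ℝ} {x : E} (hg : ContDiffAt ℝ 2 g x) (h0 : fderiv ℝ g x = 0) :
    ∃ C > 0, ∀ᶠ u in 𝓝 x, |g u - g x| ≤ C * ‖u - x‖ ^ 2 := by
  have h1 : ContDiffAt ℝ 1 (fderiv ℝ g) x := hg.fderiv_right (by norm_num)
  obtain ⟨K, t, ht, hK⟩ := h1.exists_lipschitzOnWith
  have hd : ∀ᶠ u in 𝓝 x, DifferentiableAt ℝ g u :=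
    (hg.eventually (by simp)).mono fun u hu => hu.differentiableAt (by simp)
  obtain ⟨r, hr, hball⟩ := Metric.eventually_nhds_iff_ball.1 (hd.and ht)
  refine ⟨K + 1, by positivity, ?_⟩
  filter_upwards [Metric.ball_mem_nhds x hr] with u hu
  have hxt : x ∈ t := mem_of_mem_nhds ht
  have key := (convex_closedBall x ‖u - x‖).norm_image_sub_le_of_norm_fderiv_le (𝕜 := ℝ) (f := g)
    (C := K * ‖u - x‖) (x := x) (y := u) (fun w hw => ?_) (fun w hw => ?_)
    (Metric.mem_closedBall_self (norm_nonneg _)) (by simp [dist_eq_norm])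
  · rw [Real.norm_eq_abs] at key
    nlinarith [sq_nonneg ‖u - x‖]
  all_goals
    have hw' : w ∈ Metric.ball x r := by
      rw [Metric.mem_ball, dist_eq_norm] at *
      rw [Metric.mem_closedBall, dist_eq_norm] at hw
      exact hw.trans_lt hu
  · exact (hball w hw').1
  · have := hK.dist_le_mul w (hball w hw').2 x hxt
    rw [h0, dist_zero_right] at this
    refine this.trans ?_
    have : dist w x ≤ ‖u - x‖ := hw
    gcongr

theorem IsCompactSubmanifold.two_mul_lfs_mul_inner_le {N m : ℕ} {M : Set (Euc N)}
    [ChartedSpace (Euc m) M] (hM : IsCompactSubmanifold m M) (y : M) {n : Euc N}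
    (hn : n ∈ (tangentDir m M y)ᗮ) {z : Euc N} (hz : z ∈ M) :
    2 * lfs M y * inner ℝ (z - y) n ≤ ‖z - y‖ ^ 2 * ‖n‖ := by
  have hunit : ∀ n ∈ (tangentDir m M y)ᗮ, ‖n‖ = 1 →
      ∃ s₀ > 0, ∀ z ∈ M, 2 * s₀ * inner ℝ (z - y) n ≤ ‖z - y‖ ^ 2 := by
    intro n hn hn1
    obtain ⟨e, L, hy, hsm, hL, h⟩ := hM.exists_parametrization y
    have hu := e.map_source hy
    set φ : Euc m → Euc N := fun u => (e.symm u : Euc N) with hφ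
    have hφy : φ (e y) = y := by simp only [hφ, e.left_inv hy]
    have hφc : ContDiffAt ℝ ∞ φ (e y) := hsm.contDiffAt (e.open_target.mem_nhds hu)
    have hg : ContDiffAt ℝ 2 (fun u => inner ℝ (φ u - y) n) (e y) := by
      have : ContDiffAt ℝ 2 φ (e y) := hφc.of_le (WithTop.coe_le_coe.2 (le_top : (2 : ℕ∞) ≤ ⊤))
      exact (this.sub contDiffAt_const).inner ℝ contDiffAt_const
    have hg0 : fderiv ℝ (fun u => inner ℝ (φ u - y) n) (e y) = 0 := by
      have hd : DifferentiableAt ℝ φ (e y) := hφc.differentiableAt (by simp)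
      ext v
      rw [fderiv_inner_apply ℝ (by fun_prop) (by fun_prop), fderiv_sub_const]
      simp only [fderiv_fun_const, Pi.zero_apply, zero_apply, inner_zero_right, zero_add]
      refine (Submodule.mem_orthogonal _ _).1 hn _ ?_
      have := (h _ hu).2.2
      rw [e.left_inv hy] at this
      rw [← this]
      exact ⟨v, rfl⟩
    obtain ⟨C, hC, hCu⟩ := isBigO_sub_sq_of_fderiv_eq_zero hg hg0
    obtain ⟨K, hK⟩ := (hL y hy).2.isBigO_sub.bound
    have hev : ∀ᶠ z : M in 𝓝 y, inner ℝ ((z : Euc N) - y) n ≤ C * (|K| * ‖(z : Euc N) - y‖) ^ 2 := by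
      have h1 : ∀ᶠ z : M in 𝓝 y, ‖L z - L y‖ ≤ K * ‖(z : Euc N) - y‖ :=
        (continuous_subtype_val.tendsto y).eventually hK
      have h2 := (e.continuousAt hy).eventually hCu
      filter_upwards [h1, h2, e.open_source.mem_nhds hy] with z hz1 hz2 hzs
      rw [(hL z hzs).1, (hL y hy).1] at hz1
      have e1 : φ (e z) = z := by simp only [hφ, e.left_inv hzs]
      simp only [e1, hφy, sub_self, inner_zero_left, sub_zero] at hz2
      refine (le_abs_self _).trans (hz2.trans ?_)
      have : ‖e z - e y‖ ≤ |K| * ‖(z : Euc N) - y‖ :=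
        hz1.trans (by gcongr; exact le_abs_self K)
      gcongr
    obtain ⟨δ, hδ, hball⟩ := Metric.eventually_nhds_iff_ball.1 hev
    set D := C * |K| ^ 2 + 1 with hD
    have hDpos : 0 < D := by positivity
    -- Within `δ` of `y` the quadratic contact bound applies; farther away Cauchy–Schwarz suffices.
    refine ⟨min (1 / (2 * D)) (δ / 2), lt_min (by positivity) (by positivity), fun z hz => ?_⟩
    rcases le_or_gt (inner ℝ (z - y) n) 0 with hneg | hpos
    · have : 0 < min (1 / (2 * D)) (δ / 2) := lt_min (by positivity) (by positivity)
      nlinarith [sq_nonneg ‖z - y‖]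
    rcases lt_or_ge (dist z y) δ with hlt | hge
    · have h1 := hball ⟨z, hz⟩ hlt
      have h1' : inner ℝ (z - y) n ≤ D * ‖z - y‖ ^ 2 := by
        refine h1.trans ?_
        rw [hD]; nlinarith [sq_nonneg ‖z - y‖]
      calc 2 * min (1 / (2 * D)) (δ / 2) * inner ℝ (z - y) n
          ≤ 2 * (1 / (2 * D)) * inner ℝ (z - y) n := by gcongr; exact min_le_left _ _
        _ ≤ 2 * (1 / (2 * D)) * (D * ‖z - y‖ ^ 2) := by gcongr
        _ = ‖z - y‖ ^ 2 := by field_simp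
    · have h2 : inner ℝ (z - y) n ≤ ‖z - y‖ := by
        simpa [hn1] using real_inner_le_norm (z - y : Euc N) n
      rw [dist_eq_norm] at hge
      calc 2 * min (1 / (2 * D)) (δ / 2) * inner ℝ (z - y) n
          ≤ 2 * (δ / 2) * inner ℝ (z - y) n := by gcongr; exact min_le_right _ _
        _ ≤ ‖z - y‖ ^ 2 := by nlinarith
  rcases eq_or_ne n 0 with rfl | hn0
  · simp
  have hpos : 0 < ‖n‖ := norm_pos_iff.2 hn0
  have h1 : ‖‖n‖⁻¹ • n‖ = 1 := by
    rw [norm_smul, norm_inv, norm_norm, inv_mul_cancel₀ hpos.ne']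
  obtain ⟨s₀, hs₀, h⟩ := hunit _ (Submodule.smul_mem _ ‖n‖⁻¹ hn) h1
  have h2 := _root_.two_mul_lfs_mul_inner_le hM.isCompact y.2 h1 hs₀ h z hz
  rw [real_inner_smul_right] at h2
  have h3 := mul_le_mul_of_nonneg_right h2 hpos.le
  calc _ = 2 * lfs M y * (‖n‖⁻¹ * inner ℝ (z - y) n) * ‖n‖ := by field_simp
    _ ≤ _ := h3

/-! ### Angles between subspaces of equal dimension. -/

section Subspaces

variable {E : Type*} [NormedAddCommGroup E] [InnerProductSpace ℝ E] [FiniteDimensional ℝ E]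

theorem norm_sub_starProjection_sq (T : Submodule ℝ E) (w : E) :
    ‖w - T.starProjection w‖ ^ 2 = ‖w‖ ^ 2 - ‖T.starProjection w‖ ^ 2 := by
  have h := T.norm_sq_eq_add_norm_sq_starProjection w
  rw [Submodule.starProjection_orthogonal_val] at h
  linarith

theorem exists_mem_starProjection_eq {T T' : Submodule ℝ E}
    (hdim : Module.finrank ℝ T' = Module.finrank ℝ T) (hd : Disjoint T' Tᗮ) {w : E} (hw : w ∈ T) :
    ∃ t ∈ T', T.starProjection t = w := by
  let f : T' →ₗ[ℝ] T :=
    ((T.starProjection : E →ₗ[ℝ] E).comp T'.subtype).codRestrict T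
      fun x => T.starProjection_apply_mem x
  have hf : Function.Injective f := by
    rw [injective_iff_map_eq_zero]
    intro x hx
    have h0 : T.starProjection x = 0 := congrArg Subtype.val hx
    have := Submodule.disjoint_def.1 hd x x.2 ((Submodule.starProjection_apply_eq_zero_iff _).1 h0)
    exact Subtype.ext this
  obtain ⟨t, ht⟩ := (LinearMap.injective_iff_surjective_of_finrank_eq_finrank hdim).1 hf ⟨w, hw⟩
  exact ⟨t, t.2, congrArg Subtype.val ht⟩

/-- Every `t'` is the projection of some `t ∈ T`, and the angle between the two is the same seen
from either side. As `w` is orthogonal to `t`, only the part of `t'` orthogonal to `t` contributes.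
-/
theorem abs_inner_le_of_norm_sub_starProjection_le {T T' : Submodule ℝ E}
    (hdim : Module.finrank ℝ T = Module.finrank ℝ T') {c : ℝ} (hc0 : 0 ≤ c) (hc1 : c < 1)
    (h : ∀ t ∈ T, ‖t - T'.starProjection t‖ ≤ c * ‖t‖) {t' w : E} (ht' : t' ∈ T') (hw : w ∈ Tᗮ) :
    |inner ℝ t' w| ≤ c * ‖t'‖ * ‖w‖ := by
  have hdis : Disjoint T T'ᗮ := by
    rw [Submodule.disjoint_def]
    intro x hx hx'
    have h1 := h x hx
    rw [(Submodule.starProjection_apply_eq_zero_iff _).2 hx', sub_zero] at h1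
    have : ‖x‖ = 0 := by nlinarith [norm_nonneg x]
    exact norm_eq_zero.1 this
  obtain ⟨t, ht, rfl⟩ := exists_mem_starProjection_eq hdim hdis ht'
  set t' := T'.starProjection t with ht'_def
  rcases eq_or_ne t 0 with rfl | ht0
  · simp [ht'_def]
  have htpos : 0 < ‖t‖ ^ 2 := by have := norm_pos_iff.2 ht0; positivity
  have h1 : ‖t‖ ^ 2 - ‖t'‖ ^ 2 ≤ c ^ 2 * ‖t‖ ^ 2 := by
    rw [← norm_sub_starProjection_sq, ← mul_pow]
    have := h t ht
    gcongr
  have hin : inner ℝ t' t = ‖t'‖ ^ 2 := by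
    have := Submodule.inner_starProjection_left_eq_right T' t' t
    rw [Submodule.starProjection_eq_self_iff.2 ht', ← ht'_def, real_inner_self_eq_norm_sq] at this
    exact this
  -- `l • t` is the orthogonal projection of `t'` onto the line of `t`.
  set l := ‖t'‖ ^ 2 / ‖t‖ ^ 2 with hl
  have hll : l * ‖t‖ ^ 2 = ‖t'‖ ^ 2 := by rw [hl]; field_simp
  have h2 : ‖t' - l • t‖ ^ 2 ≤ (c * ‖t'‖) ^ 2 := by
    rw [norm_sub_sq_real, real_inner_smul_right, hin, norm_smul, mul_pow, Real.norm_eq_abs, sq_abs]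
    have e : l ^ 2 * ‖t‖ ^ 2 = l * ‖t'‖ ^ 2 := by rw [← hll]; ring
    rw [e]
    have h3 : 1 - l ≤ c ^ 2 := by
      rw [← hll] at h1
      nlinarith
    nlinarith [sq_nonneg ‖t'‖]
  have h3 : ‖t' - l • t‖ ≤ c * ‖t'‖ := le_of_sq_le_sq h2 (by positivity)
  have h4 : inner ℝ t' w = inner ℝ (t' - l • t) w := by
    rw [inner_sub_left, real_inner_smul_left, (Submodule.mem_orthogonal _ _).1 hw t ht]; ring
  rw [h4]
  refine (abs_real_inner_le_norm _ _).trans ?_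
  gcongr

end Subspaces

/-! ### Federer's estimate, transversality and tilt of tangent spaces. -/

theorem lfs_le_add_dist {N : ℕ} (S : Set (Euc N)) (x y : Euc N) :
    lfs S x ≤ lfs S y + dist x y := Metric.infDist_le_infDist_add_dist

section Projection

variable {N m : ℕ} {M : Set (Euc N)} [ChartedSpace (Euc m) M]

theorem IsCompactSubmanifold.two_mul_lfs_mul_norm_le (hM : IsCompactSubmanifold m M) (y z : M) :
    2 * lfs M y * ‖(z - y : Euc N) - (tangentDir m M y).starProjection (z - y)‖ ≤
      ‖(z - y : Euc N)‖ ^ 2 := by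
  set w : Euc N := z - y
  set n : Euc N := w - (tangentDir m M y).starProjection w with hn
  have hnm : n ∈ (tangentDir m M y)ᗮ := Submodule.sub_starProjection_mem_orthogonal w
  have h := hM.two_mul_lfs_mul_inner_le y hnm z.2
  have hin : inner ℝ w n = ‖n‖ ^ 2 := by
    have e : w = n + (tangentDir m M y).starProjection w := by rw [hn]; abel
    conv_lhs => rw [e]
    rw [inner_add_left, real_inner_self_eq_norm_sq,
      (Submodule.mem_orthogonal _ _).1 hnm _ (Submodule.starProjection_apply_mem _ w), add_zero]
  change 2 * lfs M y * inner ℝ w n ≤ ‖w‖ ^ 2 * ‖n‖ at h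
  rw [hin] at h
  rcases (norm_nonneg n).eq_or_lt with h0 | hpos
  · rw [← h0]; simp
  · refine le_of_mul_le_mul_right ?_ hpos
    calc _ = 2 * lfs M y * ‖n‖ ^ 2 := by ring
      _ ≤ _ := h

/-- Transversality is injectivity of the projected differential of a parametrization, an open
condition. -/
theorem IsCompactSubmanifold.isOpen_disjoint_orthogonal (hM : IsCompactSubmanifold m M)
    (T : Submodule ℝ (Euc N)) : IsOpen {y : M | Disjoint (tangentDir m M y) Tᗮ} := by
  rw [isOpen_iff_mem_nhds]
  intro y hy
  obtain ⟨e, L, hye, hsm, -, h⟩ := hM.exists_parametrization y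
  have hu := e.map_source hye
  set φ : Euc m → Euc N := fun u => (e.symm u : Euc N) with hφ
  have hcont : ContinuousAt (fderiv ℝ φ) (e y) :=
    (hsm.continuousOn_fderiv_of_isOpen e.open_target (by simp)).continuousAt
      (e.open_target.mem_nhds hu)
  have hcont2 : ContinuousAt (fun z : M => T.starProjection.comp (fderiv ℝ φ (e z))) y := by
    have h1 : ContinuousAt (fun z : M => fderiv ℝ φ (e z)) y :=
      ContinuousAt.comp (g := fderiv ℝ φ) hcont (e.continuousAt hye)
    exact continuousAt_const.clm_comp h1
  have hinj : Function.Injective (T.starProjection.comp (fderiv ℝ φ (e y))) := by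
    rw [injective_iff_map_eq_zero]
    intro v hv
    have hr := (h _ hu).2.2
    rw [e.left_inv hye] at hr
    have hmem : fderiv ℝ φ (e y) v ∈ tangentDir m M y := hr ▸ ⟨v, rfl⟩
    have h0 : fderiv ℝ φ (e y) v = 0 := Submodule.disjoint_def.1 hy _ hmem
      ((Submodule.starProjection_apply_eq_zero_iff _).1 hv)
    exact (h _ hu).1 (h0.trans (map_zero _).symm)
  filter_upwards [hcont2 (ContinuousLinearMap.isOpen_injective.mem_nhds hinj),
    e.open_source.mem_nhds hye] with z hz hzs
  have hr := (h _ (e.map_source hzs)).2.2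
  rw [e.left_inv hzs] at hr
  change Disjoint _ _
  rw [Submodule.disjoint_def, ← hr]
  rintro w ⟨v, rfl⟩ hw
  have h0 : T.starProjection.comp (fderiv ℝ φ (e z)) v = 0 :=
    (Submodule.starProjection_apply_eq_zero_iff _).2 hw
  have : v = 0 := hz (h0.trans (map_zero _).symm)
  rw [this]; exact map_zero _

/-- The residual is orthogonal to the projection of the tangent space at `y`, which by
transversality and equal dimension is all of `T_p M`; lying in `T_p M` itself, it vanishes. -/
theorem IsCompactSubmanifold.starProjection_eq_of_isLocalMin (hM : IsCompactSubmanifold m M)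
    {p y : M} (hy : Disjoint (tangentDir m M y) (tangentDir m M p)ᗮ) {w : Euc N}
    (hw : w ∈ tangentDir m M p)
    (hmin : ∀ᶠ z : M in 𝓝 y, ‖w - (tangentDir m M p).starProjection (y - p)‖ ≤
      ‖w - (tangentDir m M p).starProjection (z - p)‖) :
    (tangentDir m M p).starProjection (y - p) = w := by
  obtain ⟨e, L, hye, hsm, -, h⟩ := hM.exists_parametrization y
  have hu := e.map_source hye
  set φ : Euc m → Euc N := fun u => (e.symm u : Euc N) with hφ
  set P := (tangentDir m M p).starProjection with hP
  have hφy : φ (e y) = y := by simp only [hφ, e.left_inv hye]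
  have hφd : HasFDerivAt φ (fderiv ℝ φ (e y)) (e y) :=
    ((hsm.differentiableOn (by simp)).differentiableAt (e.open_target.mem_nhds hu)).hasFDerivAt
  have hg := ((P.hasFDerivAt.comp (e y) (hφd.sub_const (p : Euc N))).const_sub w).norm_sq
  have hloc : IsLocalMin (fun u => ‖w - (P ∘ fun u => φ u - p) u‖ ^ 2) (e y) := by
    have hc : ContinuousAt e.symm (e y) := e.continuousAt_symm hu
    have hmin' : ∀ᶠ u in 𝓝 (e y), ‖w - P (y - p)‖ ≤ ‖w - P ((e.symm u : Euc N) - p)‖ := by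
      rw [ContinuousAt, e.left_inv hye] at hc
      exact hc.eventually hmin
    filter_upwards [hmin'] with u hu
    simp only [Function.comp, hφy]
    gcongr
  have h0 := hloc.hasFDerivAt_eq_zero hg
  have hmem : w - P (y - p) ∈ tangentDir m M p :=
    Submodule.sub_mem _ hw (Submodule.starProjection_apply_mem _ _)
  obtain ⟨t, ht, htw⟩ := exists_mem_starProjection_eq
    ((hM.finrank_tangentDir y).trans (hM.finrank_tangentDir p).symm) hy hmem
  have hr := (h _ hu).2.2
  rw [e.left_inv hye] at hr
  rw [← hr] at ht
  obtain ⟨v, rfl⟩ := ht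
  have h1 := DFunLike.congr_fun h0 v
  have h2 : P (fderiv ℝ φ (e y) v) = w - P (y - p) := htw
  simp [h2, hφy, -map_sub] at h1
  exact (sub_eq_zero.1 h1).symm

theorem IsCompactSubmanifold.exists_starProjection_eq (hM : IsCompactSubmanifold m M) {p : M}
    {ρ : ℝ} (hρ : 0 < ρ) (hρl : ρ ≤ lfs M p / 10)
    (hgood : ∀ y : M, dist y p ≤ ρ → Disjoint (tangentDir m M y) (tangentDir m M p)ᗮ)
    {w : Euc N} (hw : w ∈ tangentDir m M p) (hwn : ‖w‖ ≤ 19 / 20 * ρ) :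
    ∃ y : M, dist y p ≤ ρ ∧ (tangentDir m M p).starProjection (y - p) = w := by
  have : CompactSpace M := isCompact_iff_compactSpace.1 hM.isCompact
  set P := (tangentDir m M p).starProjection with hP
  let F : M → Euc N := fun z => P (z - p)
  have hF : Continuous F := by fun_prop
  set A := F '' Metric.closedBall p ρ with hA
  have hAc : IsCompact A := (isCompact_closedBall p ρ).image hF
  have h0A : (0 : Euc N) ∈ A := ⟨p, Metric.mem_closedBall_self hρ.le, by simp [F]⟩
  by_contra hcon
  have hwA : w ∉ A := by
    rintro ⟨y, hy, hyw⟩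
    exact hcon ⟨y, hy, hyw⟩
  let f : ℝ → ℝ := fun s => Metric.infDist (s • w) A
  have hf : Continuous f := (Metric.continuous_infDist_pt A).comp (by fun_prop)
  have hf0 : f 0 = 0 := by simp only [f, zero_smul]; exact Metric.infDist_zero_of_mem h0A
  have hf1 : 0 < f 1 := by
    simp only [f, one_smul]
    exact (hAc.isClosed.notMem_iff_infDist_pos ⟨0, h0A⟩).1 hwA
  -- Replacing `w` by `s • w`, at positive distance at most `ρ / 200` from the image, keeps the
  -- nearest image point short, while points of the sphere of radius `ρ` project to length close to
  -- `ρ`. The minimiser is therefore interior.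
  have hc : min (f 1) (ρ / 200) ∈ Set.Icc (f 0) (f 1) :=
    ⟨by rw [hf0]; positivity, min_le_left _ _⟩
  obtain ⟨s, hs, hfs⟩ := intermediate_value_Icc zero_le_one hf.continuousOn hc
  have hfs0 : 0 < f s := by rw [hfs]; positivity
  have hfs1 : f s ≤ ρ / 200 := hfs ▸ min_le_right _ _
  obtain ⟨a, ⟨y, hy, rfl⟩, hya⟩ := hAc.exists_infDist_eq_dist ⟨0, h0A⟩ (s • w)
  change f s = _ at hya
  have hFy : ‖F y‖ ≤ 191 / 200 * ρ := by
    have h1 : ‖F y‖ ≤ ‖s • w‖ + dist (s • w) (F y) := by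
      rw [dist_eq_norm]
      calc ‖F y‖ = ‖s • w - (s • w - F y)‖ := by rw [sub_sub_cancel]
        _ ≤ _ := norm_sub_le _ _
    have h2 : ‖s • w‖ ≤ ‖w‖ := by
      rw [norm_smul, Real.norm_of_nonneg hs.1]
      exact mul_le_of_le_one_left (norm_nonneg _) hs.2
    linarith
  have hint : dist y p < ρ := by
    refine lt_of_le_of_ne hy fun heq => ?_
    have h1 := hM.two_mul_lfs_mul_norm_le p y
    rw [← hP] at h1
    have h2 := norm_sub_starProjection_sq (tangentDir m M p) ((y : Euc N) - p)
    rw [← hP] at h2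
    have h3 : ‖(y : Euc N) - p‖ = ρ := by rw [← dist_eq_norm]; exact heq
    rw [h3] at h1 h2
    set b := ‖(y : Euc N) - p - P (y - p)‖ with hb
    have hb0 : 0 ≤ b := norm_nonneg _
    have h4 : b ≤ ρ / 20 := by
      have : 20 * ρ * b ≤ ρ ^ 2 :=
        le_trans (mul_le_mul_of_nonneg_right (by linarith) hb0) h1
      nlinarith
    change b ^ 2 = ρ ^ 2 - ‖F y‖ ^ 2 at h2
    nlinarith [norm_nonneg (F y)]
  have heq : P (y - p) = s • w := by
    refine hM.starProjection_eq_of_isLocalMin (hgood y hy) (Submodule.smul_mem _ s hw) ?_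
    filter_upwards [Metric.isOpen_ball.mem_nhds (show y ∈ Metric.ball p ρ from hint)] with z hz
    have h1 : f s ≤ dist (s • w) (F z) :=
      Metric.infDist_le_dist_of_mem ⟨z, Metric.ball_subset_closedBall hz, rfl⟩
    rw [hya, dist_eq_norm, dist_eq_norm] at h1
    exact h1
  have : f s = 0 := by rw [hya]; exact dist_eq_zero.2 heq.symm
  exact hfs0.ne' this

theorem IsCompactSubmanifold.norm_sub_starProjection_le_of_good (hM : IsCompactSubmanifold m M)
    {p y : M} (hy : dist y p ≤ lfs M p / 10)
    (hgood : ∀ z : M, dist z p < dist y p → Disjoint (tangentDir m M z) (tangentDir m M p)ᗮ)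
    {t : Euc N} (ht : t ∈ tangentDir m M p) :
    ‖t - (tangentDir m M y).starProjection t‖ ≤ 1 / 2 * ‖t‖ := by
  rcases eq_or_ne y p with rfl | hyp
  · rw [Submodule.starProjection_eq_self_iff.2 ht, sub_self, norm_zero]; positivity
  rcases eq_or_ne t 0 with rfl | ht0
  · simp
  set ρ := dist y p with hρ
  have hρ0 : 0 < ρ := dist_pos.2 hyp
  have htpos : 0 < ‖t‖ := norm_pos_iff.2 ht0
  -- A radius below `ρ` keeps the closed ball among the points known to be good, and `9/10 ≤ 19/20 *
  -- 24/25`.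
  obtain ⟨q, hq, hqw⟩ := hM.exists_starProjection_eq (ρ := 24 / 25 * ρ) (by positivity)
    (by linarith) (fun z hz => hgood z (by linarith))
    (Submodule.smul_mem _ (9 / 10 * ρ / ‖t‖) ht) (by
      rw [norm_smul, Real.norm_of_nonneg (by positivity), div_mul_cancel₀ _ htpos.ne']
      linarith)
  set Q := (tangentDir m M y).starProjection
  have hQ : ∀ u, ‖u - Q u‖ ≤ ‖u‖ := fun u => by
    refine le_of_sq_le_sq ?_ (norm_nonneg _)
    rw [norm_sub_starProjection_sq]
    nlinarith [sq_nonneg ‖(tangentDir m M y).starProjection u‖]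
  have hlfs : 9 * ρ ≤ lfs M y := by
    have := lfs_le_add_dist M (p : Euc N) y
    rw [dist_comm] at this
    have e : dist (y : Euc N) p = ρ := rfl
    linarith
  have bound : ∀ {l b d c k : ℝ}, 2 * l * b ≤ d ^ 2 → 0 ≤ b → 0 ≤ d → d ≤ c * ρ → k * ρ ≤ l →
      2 * k * b ≤ c ^ 2 * ρ := by
    intro l b d c k h hb hd hdc hkl
    have h1 : d ^ 2 ≤ (c * ρ) ^ 2 := by gcongr
    have h2 : k * ρ * b ≤ l * b := by gcongr
    refine le_of_mul_le_mul_right ?_ hρ0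
    nlinarith
  have hpy : ‖(p - y : Euc N)‖ = ρ := by rw [← dist_eq_norm, dist_comm]; rfl
  have hqp : ‖(q - p : Euc N)‖ ≤ 24 / 25 * ρ := by rw [← dist_eq_norm]; exact hq
  have hqy : ‖(q - y : Euc N)‖ ≤ 49 / 25 * ρ := by
    have : ‖(q - y : Euc N)‖ ≤ ‖(q - p : Euc N)‖ + ‖(p - y : Euc N)‖ := norm_sub_le_norm_sub_add_norm_sub _ _ _
    linarith
  have b1 := bound (hM.two_mul_lfs_mul_norm_le y q) (norm_nonneg _) (norm_nonneg _) hqy hlfs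
  have b2 := bound (c := 1) (hM.two_mul_lfs_mul_norm_le y p) (norm_nonneg _) (norm_nonneg _)
    (by rw [hpy, one_mul]) hlfs
  have b3 := bound (k := 10) (hM.two_mul_lfs_mul_norm_le p q) (norm_nonneg _) (norm_nonneg _)
    hqp (by linarith)
  rw [hqw] at b3
  set w := (9 / 10 * ρ / ‖t‖) • t with hw
  -- Federer's estimate controls the first two terms at `y` and the third at `p`.
  have hdec : w - Q w = ((q - y : Euc N) - Q (q - y)) - ((p - y : Euc N) - Q (p - y)) -
      ((q - p - w : Euc N) - Q (q - p - w)) := by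
    simp only [map_sub]; abel
  have hwQ : ‖w - Q w‖ ≤ 9 / 20 * ρ := by
    rw [hdec]
    have h1 := norm_sub_le (((q - y : Euc N) - Q (q - y)) - ((p - y : Euc N) - Q (p - y)))
      ((q - p - w : Euc N) - Q (q - p - w))
    have h2 := norm_sub_le ((q - y : Euc N) - Q (q - y)) ((p - y : Euc N) - Q (p - y))
    have h3 := hQ (q - p - w : Euc N)
    linarith
  have hwt : ‖w - Q w‖ = 9 / 10 * ρ / ‖t‖ * ‖t - Q t‖ := by
    rw [hw, map_smul, ← smul_sub, norm_smul, Real.norm_of_nonneg (by positivity)]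
  rw [hwt, div_mul_eq_mul_div, div_le_iff₀ htpos] at hwQ
  refine le_of_mul_le_mul_left ?_ hρ0
  linarith

theorem IsCompactSubmanifold.norm_sub_starProjection_le (hM : IsCompactSubmanifold m M)
    {p y : M} (hy : dist y p ≤ lfs M p / 10) {t : Euc N} (ht : t ∈ tangentDir m M p) :
    ‖t - (tangentDir m M y).starProjection t‖ ≤ 1 / 2 * ‖t‖ := by
  have : CompactSpace M := isCompact_iff_compactSpace.1 hM.isCompact
  refine hM.norm_sub_starProjection_le_of_good hy (fun z hz => ?_) ht
  by_contra hbad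
  set B : Set M := Metric.closedBall p (lfs M p / 10) ∩
    {y : M | Disjoint (tangentDir m M y) (tangentDir m M p)ᗮ}ᶜ
  have hB : IsCompact B := (isCompact_closedBall p _).inter_right
    (hM.isOpen_disjoint_orthogonal (tangentDir m M p)).isClosed_compl
  -- At a closest bad point all strictly closer points are good, so the tilt bound holds there and
  -- contradicts badness.
  obtain ⟨x, hx, hmin⟩ := hB.exists_isMinOn ⟨z, (hz.le.trans hy : dist z p ≤ _), hbad⟩
    (f := fun x => dist x p) (by fun_prop)
  refine hx.2 ?_
  change Disjoint _ _
  rw [Submodule.disjoint_def]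
  intro v hv hv'
  have hangle := abs_inner_le_of_norm_sub_starProjection_le
    ((hM.finrank_tangentDir p).trans (hM.finrank_tangentDir x).symm)
    (by norm_num : (0 : ℝ) ≤ 1 / 2) (by norm_num) (fun t ht =>
      hM.norm_sub_starProjection_le_of_good hx.1 (fun z' hz' => by
        by_contra hc
        have h1 : dist z' p ≤ lfs M p / 10 := hz'.le.trans hx.1
        exact absurd (hmin ⟨h1, hc⟩) (not_le.2 hz')) ht) hv hv'
  rw [real_inner_self_eq_norm_sq, abs_of_nonneg (by positivity)] at hangle
  have : ‖v‖ ^ 2 ≤ 0 := by nlinarith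
  exact norm_eq_zero.1 (pow_eq_zero_iff (two_ne_zero) |>.1 (le_antisymm this (by positivity)))

theorem IsCompactSubmanifold.abs_inner_le (hM : IsCompactSubmanifold m M)
    {p y : M} (hy : dist y p ≤ lfs M p / 10) {t w : Euc N} (ht : t ∈ tangentDir m M y)
    (hw : w ∈ (tangentDir m M p)ᗮ) : |inner ℝ t w| ≤ 1 / 2 * ‖t‖ * ‖w‖ :=
  abs_inner_le_of_norm_sub_starProjection_le
    ((hM.finrank_tangentDir p).trans (hM.finrank_tangentDir y).symm)
    (by norm_num) (by norm_num) (fun _ ht => hM.norm_sub_starProjection_le hy ht) ht hw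

theorem IsCompactSubmanifold.disjoint_tangentDir_orthogonal (hM : IsCompactSubmanifold m M)
    {p y : M} (hy : dist y p ≤ lfs M p / 10) :
    Disjoint (tangentDir m M y) (tangentDir m M p)ᗮ := by
  rw [Submodule.disjoint_def]
  intro v hv hv'
  have h := hM.abs_inner_le hy hv hv'
  rw [real_inner_self_eq_norm_sq, abs_of_nonneg (by positivity)] at h
  have : ‖v‖ ^ 2 ≤ 0 := by nlinarith
  exact norm_eq_zero.1 (pow_eq_zero_iff (two_ne_zero) |>.1 (le_antisymm this (by positivity)))

/-! ### Injectivity, surjectivity and height of the projection. -/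

/-- A chord normal at `p` would be tangent at `y` up to `1/9` of its length, while the tilt bound
allows its tangential part only a factor `1/2`; but `1/2 + 1/9 < 1`. -/
theorem IsCompactSubmanifold.eq_of_sub_mem_orthogonal (hM : IsCompactSubmanifold m M)
    {p y z : M} (hy : dist y p ≤ lfs M p / 10) (hz : dist z p ≤ lfs M p / 10)
    (h : (z - y : Euc N) ∈ (tangentDir m M p)ᗮ) : z = y := by
  by_contra hne
  set w : Euc N := z - y with hw
  have hwpos : 0 < ‖w‖ := by
    rw [hw, ← dist_eq_norm]; exact dist_pos.2 fun e => hne (Subtype.ext e)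
  have hwl : ‖w‖ ≤ lfs M p / 5 := by
    rw [hw, ← dist_eq_norm]
    have : dist (z : Euc N) y ≤ dist z p + dist y p := dist_triangle_right z y p
    linarith
  have hlfs : 9 / 10 * lfs M p ≤ lfs M y := by
    have h1 := lfs_le_add_dist M (p : Euc N) y
    rw [dist_comm] at h1
    have e : dist (y : Euc N) p ≤ lfs M p / 10 := hy
    linarith
  have h1 := hM.two_mul_lfs_mul_norm_le y z
  rw [← hw] at h1
  set t := (tangentDir m M y).starProjection w with ht
  have htn : ‖t‖ ≤ ‖w‖ := by
    refine le_of_sq_le_sq ?_ (norm_nonneg _)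
    have := norm_sub_starProjection_sq (tangentDir m M y) w
    nlinarith [sq_nonneg ‖w - t‖]
  have h2 : |inner ℝ t w| ≤ 1 / 2 * ‖t‖ * ‖w‖ :=
    hM.abs_inner_le hy (Submodule.starProjection_apply_mem _ w) h
  have h3 : ‖w - t‖ ≤ 1 / 9 * ‖w‖ := by
    have : 9 * ‖w‖ * ‖w - t‖ ≤ ‖w‖ ^ 2 :=
      le_trans (mul_le_mul_of_nonneg_right (by linarith) (norm_nonneg _)) h1
    nlinarith
  have h4 : ‖w‖ ^ 2 = inner ℝ t w + inner ℝ (w - t) w := by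
    rw [← inner_add_left, add_sub_cancel, real_inner_self_eq_norm_sq]
  have h5 := real_inner_le_norm (w - t) w
  have h6 := le_abs_self (inner ℝ t w)
  nlinarith

theorem coe_tangentProj (p z : M) : (tangentProj m M p z : Euc N) =
    (tangentDir m M p).starProjection (z - p) + p := by
  rw [tangentProj, EuclideanGeometry.coe_orthogonalProjection_eq_iff_mem,
    AffineSubspace.mem_mk', AffineSubspace.direction_mk']
  refine ⟨?_, ?_⟩
  · rw [vsub_eq_sub, add_sub_cancel_right]
    exact Submodule.starProjection_apply_mem _ _
  · rw [vsub_eq_sub, ← sub_sub, sub_right_comm]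
    exact Submodule.sub_starProjection_mem_orthogonal _

theorem tangentProj_eq_iff {p z : M} {x : tangentPlane m M p} : tangentProj m M p z = x ↔
    (tangentDir m M p).starProjection (z - p) = (x - p : Euc N) := by
  rw [← Subtype.coe_inj, coe_tangentProj, eq_sub_iff_add_eq]

theorem coe_sub_mem_tangentDir {p : M} (x : tangentPlane m M p) :
    (x - p : Euc N) ∈ tangentDir m M p := AffineSubspace.mem_mk'.1 x.2

theorem continuous_tangentProj (p : M) : Continuous (tangentProj m M p) := by
  refine Continuous.subtype_mk (f := fun z : M => (tangentProj m M p z : Euc N)) ?_ _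
  simp only [coe_tangentProj]
  fun_prop

theorem IsCompactSubmanifold.injOn_tangentProj (hM : IsCompactSubmanifold m M) (p : M) :
    Set.InjOn (tangentProj m M p) (Metric.closedBall p (lfs M p / 10)) := by
  intro y hy z hz h
  refine hM.eq_of_sub_mem_orthogonal hz hy ?_
  rw [tangentProj_eq_iff, coe_tangentProj, add_sub_cancel_right] at h
  rw [← Submodule.starProjection_apply_eq_zero_iff, ← sub_sub_sub_cancel_right _ _ (p : Euc N),
    map_sub, h, sub_self]

theorem IsCompactSubmanifold.injective_mfderiv_tangentProj (hM : IsCompactSubmanifold m M)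
    {p y : M} (hy : dist y p ≤ lfs M p / 10) :
    Function.Injective
      (mfderiv (𝓡 m) 𝓘(ℝ, Euc N) (fun z : M => (tangentProj m M p z : Euc N)) y) := by
  set P := (tangentDir m M p).starProjection
  let A : Euc m →L[ℝ] Euc N := mfderiv (𝓡 m) 𝓘(ℝ, Euc N) (Subtype.val : M → Euc N) y
  have hA : HasMFDerivAt (𝓡 m) 𝓘(ℝ, Euc N) (Subtype.val : M → Euc N) y A :=
    ((hM.isSmoothEmbedding.contMDiff.mdifferentiable (by simp)) y).hasMFDerivAt
  have hg : HasFDerivAt (fun w : Euc N => P (w - p) + p) P (y : Euc N) :=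
    (P.hasFDerivAt.comp (y : Euc N) ((hasFDerivAt_id (y : Euc N)).sub_const (p : Euc N))).add_const _
  have hcomp : HasMFDerivAt (𝓡 m) 𝓘(ℝ, Euc N)
      (fun z : M => (tangentProj m M p z : Euc N)) y (P.comp A) := by
    have := HasMFDerivAt.comp y hg.hasMFDerivAt hA
    refine this.congr_of_eventuallyEq (Filter.Eventually.of_forall fun z => ?_)
    exact coe_tangentProj p z
  rw [hcomp.mfderiv]
  change Function.Injective (P.comp A)
  rw [injective_iff_map_eq_zero]
  intro v hv
  have h0 : A v = 0 := Submodule.disjoint_def.1 (hM.disjoint_tangentDir_orthogonal hy) _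
    (mem_tangentDir_iff.2 ⟨v, rfl⟩) ((Submodule.starProjection_apply_eq_zero_iff _).1 hv)
  exact hM.injective_mfderiv_val y (h0.trans (map_zero A).symm)

theorem IsCompactSubmanifold.exists_tangentProj_eq (hM : IsCompactSubmanifold m M) {p : M}
    (x : tangentPlane m M p) (hx : dist (x : Euc N) p ≤ 19 * lfs M p / 200) :
    ∃ y ∈ Metric.closedBall p (lfs M p / 10), tangentProj m M p y = x := by
  rcases (show 0 ≤ lfs M p from Metric.infDist_nonneg).eq_or_lt with h0 | hpos
  · refine ⟨p, by rw [← h0]; simp, ?_⟩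
    rw [← h0] at hx
    have : (x : Euc N) = p := dist_le_zero.1 (by linarith)
    rw [tangentProj_eq_iff, this, sub_self, map_zero]
  · obtain ⟨y, hy, hyx⟩ := hM.exists_starProjection_eq (ρ := lfs M p / 10) (by positivity) le_rfl
      (fun y hy => hM.disjoint_tangentDir_orthogonal hy) (coe_sub_mem_tangentDir x)
      (by rw [← dist_eq_norm]; linarith)
    exact ⟨y, hy, tangentProj_eq_iff.2 hyx⟩

theorem one_sub_sqrt_eq_div {t : ℝ} (ht : t ^ 2 ≤ 1) :
    1 - √(1 - t ^ 2) = t ^ 2 / (1 + √(1 - t ^ 2)) := by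
  have h := Real.sq_sqrt (show 0 ≤ 1 - t ^ 2 by linarith)
  have hs := Real.sqrt_nonneg (1 - t ^ 2)
  rw [eq_div_iff (by positivity)]
  linarith

theorem IsCompactSubmanifold.norm_sub_le_of_tangentProj_eq (hM : IsCompactSubmanifold m M)
    {p y : M} {x : tangentPlane m M p} {t : ℝ} (hl : 0 < lfs M p)
    (hx : ‖(p : Euc N) - x‖ = t * lfs M p) (ht : t ^ 2 ≤ 1) (hy : dist y p ≤ lfs M p / 10)
    (hyx : tangentProj m M p y = x) : ‖(x : Euc N) - y‖ ≤ (1 - √(1 - t ^ 2)) * lfs M p := by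
  rw [tangentProj_eq_iff] at hyx
  have h1 := hM.two_mul_lfs_mul_norm_le p y
  have h2 := norm_sub_starProjection_sq (tangentDir m M p) ((y : Euc N) - p)
  rw [hyx, sub_sub_sub_cancel_right, norm_sub_rev (x : Euc N) p, hx] at h2
  rw [hyx, sub_sub_sub_cancel_right] at h1
  rw [norm_sub_rev]
  set b := ‖(y : Euc N) - x‖ with hb
  have hb0 : 0 ≤ b := norm_nonneg _
  have hyp : ‖(y : Euc N) - p‖ ≤ lfs M p / 10 := by rw [← dist_eq_norm]; exact hy
  have hbl : b ≤ lfs M p / 10 := by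
    refine hyp.trans' (le_of_sq_le_sq ?_ (norm_nonneg _))
    nlinarith [sq_nonneg (t * lfs M p)]
  have hs := Real.sq_sqrt (show 0 ≤ 1 - t ^ 2 by linarith)
  set s := √(1 - t ^ 2)
  -- With Pythagoras, Federer's estimate becomes a quadratic inequality in `b`; `b ≤ lfs M p / 10`
  -- selects the smaller root.
  have h3 : (s * lfs M p) ^ 2 ≤ (lfs M p - b) ^ 2 := by
    rw [mul_pow, hs]
    nlinarith
  have h4 := le_of_sq_le_sq h3 (by linarith)
  linarith

end Projection

theorem mainTheorem2 {N m : ℕ} (M : Set (Euc N)) [ChartedSpace (Euc m) M]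
    (hM : IsCompactSubmanifold m M) (p : M) :
    -- (i) `π_p` restricted to the closed ball of radius `lfs(p)/10` in `M` is an embedding:
    -- a homeomorphism onto its image whose differential is injective at every point
    (Topology.IsEmbedding
        ((Metric.closedBall p (lfs M p / 10)).domRestrict (tangentProj m M p)) ∧
      ∀ y ∈ Metric.closedBall p (lfs M p / 10),
        Function.Injective
          (mfderiv (𝓡 m) 𝓘(ℝ, Euc N) (fun z : M => (tangentProj m M p z : Euc N)) y)) ∧
    -- (ii) the image contains the closed ball of radius `19 lfs(p)/200` in `T_p M`
    {x : tangentPlane m M p | dist (x : Euc N) p ≤ 19 * lfs M p / 200} ⊆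
      tangentProj m M p '' Metric.closedBall p (lfs M p / 10) ∧
    -- (iii) the quantitative bounds; `y` is `π_p⁻¹(x)`
    ∀ (x : tangentPlane m M p) (t : ℝ), ‖(p : Euc N) - x‖ = t * lfs M p → t ≤ 19 / 200 →
      (∃ y ∈ Metric.closedBall p (lfs M p / 10), tangentProj m M p y = x ∧
        (∀ z ∈ Metric.closedBall p (lfs M p / 10), tangentProj m M p z = x → z = y) ∧
        ‖(x : Euc N) - y‖ ≤ t ^ 2 * lfs M p / (1 + √(1 - t ^ 2))) ∧
      Metric.infDist (x : Euc N) M ≤ (1 - √(1 - t ^ 2)) * lfs M p ∧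
      (1 - √(1 - t ^ 2)) * lfs M p = t ^ 2 * lfs M p / (1 + √(1 - t ^ 2)) := by
  have : CompactSpace M := isCompact_iff_compactSpace.1 hM.isCompact
  refine ⟨⟨?_, fun y hy => hM.injective_mfderiv_tangentProj hy⟩, fun x hx => ?_, fun x t hx ht => ?_⟩
  · have : CompactSpace (Metric.closedBall p (lfs M p / 10)) :=
      isCompact_iff_compactSpace.1 (isCompact_closedBall p _)
    exact (((continuous_tangentProj p).comp continuous_subtype_val).isClosedEmbedding
      (hM.injOn_tangentProj p).injective).isEmbedding
  · exact hM.exists_tangentProj_eq x hx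
  · have hx' : dist (x : Euc N) p = t * lfs M p := by rw [dist_comm, dist_eq_norm, hx]
    have hl0 : 0 ≤ lfs M p := Metric.infDist_nonneg
    obtain ⟨y, hy, hyx⟩ := hM.exists_tangentProj_eq x (by rw [hx']; nlinarith)
    have hbd : ‖(x : Euc N) - y‖ ≤ (1 - √(1 - t ^ 2)) * lfs M p ∧
        (1 - √(1 - t ^ 2)) * lfs M p = t ^ 2 * lfs M p / (1 + √(1 - t ^ 2)) := by
      -- If `lfs M p = 0`, then `t` is not bounded below, but the ball is `{p}` and all the
      -- quantities vanish.
      rcases hl0.eq_or_lt with h0 | hpos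
      · rw [← h0] at hy hx ⊢
        have h1 : (x : Euc N) = p := by
          rw [mul_zero, norm_eq_zero, sub_eq_zero] at hx; exact hx.symm
        have h2 : y = p := by simpa using hy
        simp [h1, h2]
      · have ht0 : 0 ≤ t := by
          by_contra hneg
          have := norm_nonneg ((p : Euc N) - x)
          nlinarith
        have ht1 : t ^ 2 ≤ 1 := by nlinarith
        refine ⟨hM.norm_sub_le_of_tangentProj_eq hpos hx ht1 hy hyx, ?_⟩
        rw [one_sub_sqrt_eq_div ht1]; ring
    refine ⟨⟨y, hy, hyx, fun z hz hzx => hM.injOn_tangentProj p hz hy (hzx.trans hyx.symm), ?_⟩,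
      ?_, hbd.2⟩
    · rw [← hbd.2]; exact hbd.1
    · refine (Metric.infDist_le_dist_of_mem y.2).trans ?_
      rw [dist_eq_norm]; exact hbd.1
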